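/- Let $\Theta$ be a finite set of states with a full-support common prior $p$, let $\ell\in\{1,\dots,L\}$ be agents with finite signal sets $X_\ell$, and put $X=X_1\times\dots\times X_L$. For each $\theta\in\Theta$ let $\pi^\theta$ be a probability distribution on $X$ with marginals $\phi^\theta_\ell$ on $X_\ell$. A state $\theta$ is drawn from $p$ and, conditional on $\theta$, signal profiles in periods $0,1,2,\dots$ are drawn i.i.d. from $\pi^\theta$; this defines a probability $\mathbb P$ on $\Omega=\Theta\times X^{\infty}$, with $\theta$-conditional versions $\mathbb P^\theta$. Agent $\ell$ observes only their own signals, and $h_{\ell t}$ is their history of signals in periods $0,\dots,t-1$. Assume that for all $\theta$ and all $\ell\neq\ell'$ the marginal of $\pi^\theta$ on $X_\ell\times X_{\ell'}$ has full support. For an event $F\subset\Omega$, let $B^q_t(F)=\{\omega:\mathbb P(F\mid h_{\ell t}(\omega))\ge q\text{ for all }\ell\}$; $F$ is $q$-evident at $t$ if $F\subset B^q_t(F)$. A set $Q\subset\Theta$, identified with the event $Q\times X^\infty$, is commonly learned if for every $q\in(0,1)$ there are a time $T$ and events $(F_t)_{t\ge0}$ such that for all $t\ge T$ and all $\theta\in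 Q$: (1) $F_t\subset B^q_t(Q)$; (2) $\mathbb P^\theta(F_t)>q$; (3) $F_t$ is $q$-evident at $t$. The identification partition $\mathcal Q_\ell$ of agent $\ell$ is the partition of $\Theta$ in which $\theta,\theta'$ share a cell if and only if $\phi^\theta_\ell=\phi^{\theta'}_\ell$. Let $\mathcal{QI}=\bigvee_\ell\mathcal Q_\ell$ be the finest partition of $\Theta$ whose cells are unions of cells of $\mathcal Q_\ell$ for every $\ell$. Then a set $Q\subset\Theta$ is commonly learned if and only if it is generated by $\mathcal{QI}$, that is, $Q$ is a (possibly empty) union of cells of $\mathcal{QI}$. -/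

import Mathlib

open MeasureTheory ProbabilityTheory

noncomputable section

/-- An information structure with state space `Θ`, agents `Fin L` and signal sets `X ℓ`:
a full-support common prior on the states and, for every state, a joint distribution of the
signal profile of one period. -/
structure InfoStructure (Θ : Type*) {L : ℕ} (X : Fin L → Type*) where
  /-- the common prior -/
  prior : PMF Θ
  /-- the prior has full support -/
  prior_pos : ∀ θ, 0 < prior θ
  /-- the joint distribution of signal profiles in each state -/
  signal : Θ → PMF (∀ ℓ, X ℓ)

namespace InfoStructure

variable {Θ : Type*} {L : ℕ} {X : Fin L → Type*}

/-- The marginal distribution of agent `ℓ`'s signal in state `θ`. -/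
def marginal (S : InfoStructure Θ X) (θ : Θ) (ℓ : Fin L) : PMF (X ℓ) :=
  (S.signal θ).map fun x => x ℓ

/-- The joint marginal distribution of the signals of agents `ℓ` and `ℓ'` in state `θ`. -/
def pairMarginal (S : InfoStructure Θ X) (θ : Θ) (ℓ ℓ' : Fin L) : PMF (X ℓ × X ℓ') :=
  (S.signal θ).map fun x => (x ℓ, x ℓ')

/-- In every state, the joint marginal of any two distinct agents' signals has full support. -/
def PairwiseFullSupport (S : InfoStructure Θ X) : Prop :=
  ∀ θ, ∀ ℓ ℓ' : Fin L, ℓ ≠ ℓ' → ∀ (a : X ℓ) (b : X ℓ'), 0 < S.pairMarginal θ ℓ ℓ' (a, b)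

/-- Agent `ℓ`'s identification partition, as an equivalence relation: two states are in the same
cell iff they give agent `ℓ` the same marginal signal distribution. -/
def identification (S : InfoStructure Θ X) (ℓ : Fin L) : Setoid Θ :=
  Setoid.ker fun θ => S.marginal θ ℓ

/-- The cells of the join of the identification partitions, i.e. of the finest partition whose
cells are unions of cells of every agent's identification partition. (In the order of `Setoid`,
larger means coarser.) -/
def commonIdentification (S : InfoStructure Θ X) : Set (Set Θ) :=
  (⨆ ℓ, S.identification ℓ).classes

/-- `Q` is generated by the join of the identification partitions: it is a union of its cells. -/
def CommonlyIdentified (S : InfoStructure Θ X) (Q : Set Θ) : Prop :=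
  ∃ C ⊆ S.commonIdentification, Q = ⋃₀ C

/-- States of the world: a state together with an infinite sequence of signal profiles. -/
abbrev World (Θ : Type*) {L : ℕ} (X : Fin L → Type*) : Type _ := Θ × (ℕ → ∀ ℓ, X ℓ)

/-- The history of agent `ℓ` at the start of period `t`: the signals of periods `0, …, t - 1`. -/
def history (ℓ : Fin L) (t : ℕ) (ω : World Θ X) : Fin t → X ℓ := fun s => ω.2 s ℓ

/-- The event that the state lies in `Q`. -/
def stateEvent (X : Fin L → Type*) (Q : Set Θ) : Set (World Θ X) := {ω | ω.1 ∈ Q}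

variable [MeasurableSpace Θ] [∀ ℓ, MeasurableSpace (X ℓ)]

/-- The law of the world conditional on the state `θ`: the state is `θ`, and the signal profiles
are drawn independently over time from the distribution `S.signal θ`. -/
def lawGiven (S : InfoStructure Θ X) (θ : Θ) : Measure (World Θ X) :=
  (Measure.dirac θ).prod (Measure.infinitePi fun _ : ℕ => (S.signal θ).toMeasure)

/-- The law of the world: the state is drawn from the prior. -/
def law [Fintype Θ] (S : InfoStructure Θ X) : Measure (World Θ X) :=
  ∑ θ, S.prior θ • S.lawGiven θ

/-- Agent `ℓ`'s posterior probability of the event `F` at time `t`, in the world `ω`: the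
conditional probability of `F` given the history of agent `ℓ` (`0` if this history has
probability zero). -/
def posterior [Fintype Θ] (S : InfoStructure Θ X) (ℓ : Fin L) (t : ℕ) (F : Set (World Θ X))
    (ω : World Θ X) : ℝ :=
  (cond S.law {ω' | history ℓ t ω' = history ℓ t ω}).real F

/-- The event that agent `ℓ` attaches at least probability `q` to `F` at time `t`. -/
def agentBelief [Fintype Θ] (S : InfoStructure Θ X) (q : ℝ) (ℓ : Fin L) (t : ℕ)
    (F : Set (World Θ X)) : Set (World Θ X) :=
  {ω | q ≤ S.posterior ℓ t F ω}

/-- The event that all agents attach at least probability `q` to `F` at time `t`. -/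
def belief [Fintype Θ] (S : InfoStructure Θ X) (q : ℝ) (t : ℕ) (F : Set (World Θ X)) :
    Set (World Θ X) :=
  ⋂ ℓ, S.agentBelief q ℓ t F

/-- `F` is `q`-evident at time `t`. -/
def IsEvident [Fintype Θ] (S : InfoStructure Θ X) (q : ℝ) (t : ℕ) (F : Set (World Θ X)) : Prop :=
  F ⊆ S.belief q t F

/-- Common learning of a set of states `Q`. -/
def CommonlyLearned [Fintype Θ] (S : InfoStructure Θ X) (Q : Set Θ) : Prop :=
  ∀ q ∈ Set.Ioo (0 : ℝ) 1, ∃ (T : ℕ) (F : ℕ → Set (World Θ X)),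
    (∀ t, MeasurableSet (F t)) ∧
      ∀ t ≥ T, ∀ θ ∈ Q,
        F t ⊆ S.belief q t (stateEvent X Q) ∧ q < (S.lawGiven θ).real (F t) ∧ S.IsEvident q t (F t)

end InfoStructure

end

/-! Necessity (`CommonlyLearned.mem_of_marginal_eq`): suppose states θ in `Q` and θ' outside `Q`
give agent ℓ the same marginal. Then ℓ's histories have the same law in both. The histories
compatible with `F t` have probability above `q` under θ, hence under θ'; yet at each of them ℓ
gives θ' at most `1 - q`. Averaging yields p(θ')q < 1 - q, which fails for q = 1/(1 + p(θ')).

Sufficiency (`commonlyLearned_of_forall_mem`): let `F t` say that the state is in `Q` and that every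
agent's empirical frequencies are δ-close in ℓ¹ to those of the true state. Chernoff bounds make it
likely. For evidence, fix an agent ℓ at a world of `F t`. States with another marginal for ℓ have
likelihood smaller by a factor exp(-tδ) (`exists_prod_freq_le`); states with the same marginal lie
in `Q`. In each of the latter, the other agents' expected counts given ℓ's history come from a
stochastic matrix with entries at least m > 0. It contracts deviations by 1 - m
(`sum_abs_condFreq_le`), so a slack of mδ is left to absorb the conditional fluctuations
(`prob_compl_typicalSet_inter_le`). Hence ℓ's posterior of `F t` is high
(`mul_sum_le_sum_of_posterior_odds`). -/

namespace InfoStructure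

/-! ### Chernoff bounds for products of finite weights -/

/-- An exponential moment bound for centred functions under a finite weight. -/
theorem sum_mul_exp_le {Y : Type*} [Fintype Y] (w g : Y → ℝ) (hw : ∀ y, 0 ≤ w y)
    (hg : ∀ y, |g y| ≤ 1) (h0 : ∑ y, w y * g y = 0) (c : ℝ) (hc : |c| ≤ 1) :
    ∑ y, w y * Real.exp (c * g y) ≤ Real.exp (c ^ 2) * ∑ y, w y := by
  -- Uses exp u ≤ 1 + u + u² for |u| ≤ 1; the linear term disappears on summation by `h0`.
  have key : ∀ y, w y * Real.exp (c * g y) ≤ w y * (1 + c ^ 2) + c * (w y * g y) := by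
    intro y
    have h1 : |c * g y| ≤ 1 := by
      rw [abs_mul]; exact mul_le_one₀ hc (abs_nonneg _) (hg y)
    have h2 := (abs_le.1 (Real.abs_exp_sub_one_sub_id_le h1)).2
    have h3 : (c * g y) ^ 2 ≤ c ^ 2 := by
      rw [mul_pow]
      exact mul_le_of_le_one_right (sq_nonneg _) ((sq_le_one_iff_abs_le_one _).2 (hg y))
    have h4 : Real.exp (c * g y) ≤ 1 + c ^ 2 + c * g y := by linarith
    calc w y * Real.exp (c * g y) ≤ w y * (1 + c ^ 2 + c * g y) :=
          mul_le_mul_of_nonneg_left h4 (hw y)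
      _ = _ := by ring
  calc ∑ y, w y * Real.exp (c * g y) ≤ ∑ y, (w y * (1 + c ^ 2) + c * (w y * g y)) :=
        Finset.sum_le_sum fun y _ => key y
    _ = (1 + c ^ 2) * ∑ y, w y := by
        rw [Finset.sum_add_distrib, ← Finset.mul_sum, h0, ← Finset.sum_mul]; ring
    _ ≤ _ := by
        refine mul_le_mul_of_nonneg_right ?_ (Finset.sum_nonneg fun y _ => hw y)
        linarith [Real.add_one_le_exp (c ^ 2)]

theorem sum_pi_prod {Y : Type*} [Fintype Y] {t : ℕ} (f : Fin t → Y → ℝ) :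
    ∑ x : Fin t → Y, ∏ s, f s (x s) = ∏ s, ∑ y, f s y := by
  classical
  rw [Finset.prod_univ_sum, Fintype.piFinset_univ]

/-- One-sided Chernoff bound for a finite product of weights. -/
theorem chernoff_one_sided {Y : Type*} [Fintype Y] {t : ℕ} (w g : Fin t → Y → ℝ)
    (hw : ∀ s y, 0 ≤ w s y) (hg : ∀ s y, |g s y| ≤ 1) (h0 : ∀ s, ∑ y, w s y * g s y = 0)
    {η : ℝ} (hη : 0 ≤ η) (hη' : η ≤ 2) :
    ∑ x : Fin t → Y, {x : Fin t → Y | t * η ≤ ∑ s, g s (x s)}.indicator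
      (fun x => ∏ s, w s (x s)) x ≤ Real.exp (-(t * (η ^ 2 / 4))) * ∏ s, ∑ y, w s y := by
  -- Exponential Markov inequality with tilt η/2: the exponent is -η²/2 + η²/4 per period, and η ≤ 2
  -- keeps the tilt within the range of `sum_mul_exp_le`.
  have key : ∀ x : Fin t → Y, {x : Fin t → Y | t * η ≤ ∑ s, g s (x s)}.indicator
      (fun x => ∏ s, w s (x s)) x ≤
      Real.exp (-(η / 2 * (t * η))) * ∏ s, w s (x s) * Real.exp (η / 2 * g s (x s)) := by
    intro x
    rw [Finset.prod_mul_distrib, ← Real.exp_sum, ← Finset.mul_sum]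
    have hp : 0 ≤ ∏ s, w s (x s) := Finset.prod_nonneg fun s _ => hw _ _
    refine Set.indicator_apply_le' (fun hx => ?_) (fun _ => by positivity)
    have : 1 ≤ Real.exp (-(η / 2 * (t * η))) * Real.exp (η / 2 * ∑ s, g s (x s)) := by
      rw [← Real.exp_add]
      refine Real.one_le_exp ?_
      have := mul_le_mul_of_nonneg_left (show t * η ≤ ∑ s, g s (x s) from hx)
        (show 0 ≤ η / 2 by positivity)
      linarith
    nlinarith
  have hexp : ∏ s, ∑ y, w s y * Real.exp (η / 2 * g s y) ≤
      ∏ s : Fin t, (Real.exp ((η / 2) ^ 2) * ∑ y, w s y) := by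
    refine Finset.prod_le_prod (fun s _ => Finset.sum_nonneg fun y _ =>
      mul_nonneg (hw s y) (Real.exp_pos _).le) fun s _ => ?_
    exact sum_mul_exp_le (w s) (g s) (hw s) (hg s) (h0 s) _
      (by rw [abs_le]; constructor <;> linarith)
  calc _ ≤ ∑ x : Fin t → Y, Real.exp (-(η / 2 * (t * η))) *
        ∏ s, w s (x s) * Real.exp (η / 2 * g s (x s)) := Finset.sum_le_sum fun x _ => key x
    _ = Real.exp (-(η / 2 * (t * η))) * ∏ s, ∑ y, w s y * Real.exp (η / 2 * g s y) := by
        rw [← Finset.mul_sum, sum_pi_prod fun s y => w s y * Real.exp (η / 2 * g s y)]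
    _ ≤ Real.exp (-(η / 2 * (t * η))) * ∏ s : Fin t, (Real.exp ((η / 2) ^ 2) * ∑ y, w s y) :=
        mul_le_mul_of_nonneg_left hexp (Real.exp_pos _).le
    _ = _ := by
        rw [Finset.prod_mul_distrib, ← mul_assoc, Finset.prod_const, ← Real.exp_nat_mul,
          ← Real.exp_add]
        congr 2
        simp
        ring

/-- Two-sided Chernoff bound for a finite product of weights. -/
theorem chernoff {Y : Type*} [Fintype Y] {t : ℕ} (w g : Fin t → Y → ℝ)
    (hw : ∀ s y, 0 ≤ w s y) (hg : ∀ s y, |g s y| ≤ 1) (h0 : ∀ s, ∑ y, w s y * g s y = 0)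
    {η : ℝ} (hη : 0 ≤ η) (hη' : η ≤ 2) :
    ∑ x : Fin t → Y, {x : Fin t → Y | t * η ≤ |∑ s, g s (x s)|}.indicator
      (fun x => ∏ s, w s (x s)) x ≤ 2 * Real.exp (-(t * (η ^ 2 / 4))) * ∏ s, ∑ y, w s y := by
  have h1 := chernoff_one_sided w g hw hg h0 hη hη'
  have h2 := chernoff_one_sided w (fun s y => -g s y) hw (by simpa using hg)
    (by simpa using h0) hη hη'
  have h3 : ∀ x : Fin t → Y, {x : Fin t → Y | t * η ≤ |∑ s, g s (x s)|}.indicator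
      (fun x => ∏ s, w s (x s)) x ≤
      {x : Fin t → Y | t * η ≤ ∑ s, g s (x s)}.indicator (fun x => ∏ s, w s (x s)) x +
      {x : Fin t → Y | t * η ≤ ∑ s, -g s (x s)}.indicator (fun x => ∏ s, w s (x s)) x := by
    intro x
    have hp : 0 ≤ ∏ s, w s (x s) := Finset.prod_nonneg fun s _ => hw _ _
    simp only [Set.indicator_apply, Set.mem_ofPred_eq, Finset.sum_neg_distrib, le_abs]
    split_ifs <;> first | linarith | tauto
  have h4 := Finset.sum_le_sum fun x (_ : x ∈ Finset.univ) => h3 x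
  rw [Finset.sum_add_distrib] at h4
  linarith

end InfoStructure

/-! ### Finite-horizon probabilities as finite sums -/

noncomputable section

namespace InfoStructure

variable {Θ : Type*} {L : ℕ} {X : Fin L → Type*}

/-- The probability of the signal profile `y` in state `θ`, as a real number. -/
def weight (S : InfoStructure Θ X) (θ : Θ) (y : ∀ ℓ, X ℓ) : ℝ := (S.signal θ y).toReal

/-- The probability of the signal `a` of agent `ℓ` in state `θ`, as a real number. -/
def freq (S : InfoStructure Θ X) (θ : Θ) (ℓ : Fin L) (a : X ℓ) : ℝ := (S.marginal θ ℓ a).toReal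

/-- The probability of the signals `a`, `b` of agents `ℓ`, `ℓ'` in state `θ`, as a real number. -/
def pairFreq (S : InfoStructure Θ X) (θ : Θ) (ℓ ℓ' : Fin L) (a : X ℓ) (b : X ℓ') : ℝ :=
  (S.pairMarginal θ ℓ ℓ' (a, b)).toReal

theorem weight_nonneg (S : InfoStructure Θ X) (θ : Θ) (y : ∀ ℓ, X ℓ) : 0 ≤ S.weight θ y :=
  ENNReal.toReal_nonneg

theorem freq_nonneg (S : InfoStructure Θ X) (θ : Θ) (ℓ : Fin L) (a : X ℓ) : 0 ≤ S.freq θ ℓ a :=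
  ENNReal.toReal_nonneg

theorem freq_le_one (S : InfoStructure Θ X) (θ : Θ) (ℓ : Fin L) (a : X ℓ) : S.freq θ ℓ a ≤ 1 :=
  ENNReal.toReal_le_of_le_ofReal zero_le_one (by simpa using PMF.coe_le_one _ _)

theorem _root_.PMF.sum_toReal_eq_one {α : Type*} [Fintype α] (p : PMF α) :
    ∑ a, (p a).toReal = 1 := by
  rw [← ENNReal.toReal_sum fun a _ => p.apply_ne_top a, ← tsum_fintype (L := .unconditional α),
    p.tsum_coe, ENNReal.toReal_one]

theorem sum_freq (S : InfoStructure Θ X) (θ : Θ) (ℓ : Fin L) [Fintype (X ℓ)] :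
    ∑ a, S.freq θ ℓ a = 1 := PMF.sum_toReal_eq_one _

open scoped Classical in
theorem _root_.PMF.map_apply_toReal {α β : Type*} [Fintype α] (p : PMF α) (f : α → β) (b : β) :
    (p.map f b).toReal = ∑ a, if f a = b then (p a).toReal else 0 := by
  rw [PMF.map_apply, tsum_fintype, ENNReal.toReal_sum]
  · refine Finset.sum_congr rfl fun a _ => ?_
    by_cases h : f a = b
    · simp [h]
    · simp [h, Ne.symm h]
  · intro a _
    split_ifs
    · exact p.apply_ne_top a
    · simp

theorem prior_toReal_pos (S : InfoStructure Θ X) (θ : Θ) : 0 < (S.prior θ).toReal :=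
  ENNReal.toReal_pos (S.prior_pos θ).ne' (S.prior.apply_ne_top θ)

theorem prod_weight_nonneg (S : InfoStructure Θ X) (θ : Θ) {t : ℕ} (x : Fin t → ∀ ℓ, X ℓ) :
    0 ≤ ∏ s, S.weight θ (x s) := Finset.prod_nonneg fun _ _ => S.weight_nonneg _ _

/-- Prefixes in which agent `ℓ` has observed the history `h`. -/
def historySet (ℓ : Fin L) {t : ℕ} (h : Fin t → X ℓ) : Set (Fin t → ∀ ℓ, X ℓ) :=
  {x | ∀ s, x s ℓ = h s}

section Fintype

variable [∀ ℓ, Fintype (X ℓ)]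

theorem sum_weight (S : InfoStructure Θ X) (θ : Θ) : ∑ y, S.weight θ y = 1 :=
  PMF.sum_toReal_eq_one _

open scoped Classical in
theorem freq_eq (S : InfoStructure Θ X) (θ : Θ) (ℓ : Fin L) (a : X ℓ) :
    S.freq θ ℓ a = ∑ y : ∀ ℓ, X ℓ, if y ℓ = a then S.weight θ y else 0 :=
  PMF.map_apply_toReal _ _ _

open scoped Classical in
theorem pairFreq_eq (S : InfoStructure Θ X) (θ : Θ) (ℓ ℓ' : Fin L) (a : X ℓ) (b : X ℓ') :
    S.pairFreq θ ℓ ℓ' a b =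
      ∑ y : ∀ ℓ, X ℓ, if y ℓ = a ∧ y ℓ' = b then S.weight θ y else 0 := by
  refine (PMF.map_apply_toReal _ _ _).trans ?_
  simp only [Prod.mk.injEq]
  rfl

theorem weight_le_freq (S : InfoStructure Θ X) (θ : Θ) (ℓ : Fin L) (y : ∀ ℓ, X ℓ) :
    S.weight θ y ≤ S.freq θ ℓ (y ℓ) := by
  classical
  rw [freq_eq]
  refine le_trans (by simp) (Finset.single_le_sum (fun z _ => ?_) (Finset.mem_univ y))
  split_ifs
  exacts [S.weight_nonneg θ z, le_rfl]

/-- The probability, in state `θ`, that the first `t` signal profiles lie in `A`. -/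
def prob (S : InfoStructure Θ X) (θ : Θ) {t : ℕ} (A : Set (Fin t → ∀ ℓ, X ℓ)) : ℝ :=
  ∑ x, A.indicator (fun x => ∏ s, S.weight θ (x s)) x

theorem prob_nonneg (S : InfoStructure Θ X) (θ : Θ) {t : ℕ} (A : Set (Fin t → ∀ ℓ, X ℓ)) :
    0 ≤ S.prob θ A :=
  Finset.sum_nonneg fun _ _ => Set.indicator_nonneg (fun x _ => S.prod_weight_nonneg θ x) _

theorem prob_univ (S : InfoStructure Θ X) (θ : Θ) (t : ℕ) :
    S.prob θ (Set.univ : Set (Fin t → ∀ ℓ, X ℓ)) = 1 := by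
  simp only [prob, Set.indicator_univ]
  rw [sum_pi_prod fun _ : Fin t => S.weight θ]
  simp [sum_weight]

theorem prob_empty (S : InfoStructure Θ X) (θ : Θ) (t : ℕ) :
    S.prob θ (∅ : Set (Fin t → ∀ ℓ, X ℓ)) = 0 := by simp [prob]

-- Conditioning on one agent's history keeps the product form: each period's weight is merely
-- restricted to the profiles with the prescribed signal. This is why the Chernoff bounds allow
-- weights that vary over time and need not sum to one.
open scoped Classical in
theorem prob_inter_historySet (S : InfoStructure Θ X) (θ : Θ) (ℓ : Fin L) {t : ℕ}
    (h : Fin t → X ℓ) (A : Set (Fin t → ∀ ℓ, X ℓ)) :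
    S.prob θ (A ∩ historySet ℓ h) =
      ∑ x, A.indicator (fun x => ∏ s, if x s ℓ = h s then S.weight θ (x s) else 0) x := by
  refine Finset.sum_congr rfl fun x _ => ?_
  by_cases hA : x ∈ A
  · by_cases hh : x ∈ historySet ℓ h
    · rw [Set.indicator_of_mem (Set.mem_inter hA hh), Set.indicator_of_mem hA]
      exact Finset.prod_congr rfl fun s _ => (if_pos (hh s)).symm
    · rw [Set.indicator_of_notMem (fun hx => hh hx.2), Set.indicator_of_mem hA]
      obtain ⟨s, hs⟩ : ∃ s, x s ℓ ≠ h s := not_forall.1 hh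
      exact (Finset.prod_eq_zero (Finset.mem_univ s) (if_neg hs)).symm
  · rw [Set.indicator_of_notMem (fun hx => hA hx.1), Set.indicator_of_notMem hA]

theorem prob_historySet (S : InfoStructure Θ X) (θ : Θ) (ℓ : Fin L) {t : ℕ} (h : Fin t → X ℓ) :
    S.prob θ (historySet ℓ h) = ∏ s, S.freq θ ℓ (h s) := by
  classical
  rw [← Set.univ_inter (historySet ℓ h), prob_inter_historySet]
  simp only [Set.indicator_univ]
  rw [sum_pi_prod fun s y => if y ℓ = h s then S.weight θ y else 0]
  simp only [freq_eq]

end Fintype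

/-- The signal profiles of the first `t` periods. -/
def pathPrefix (t : ℕ) (z : ℕ → ∀ ℓ, X ℓ) : Fin t → ∀ ℓ, X ℓ := fun s => z s

theorem setOf_history_eq (ℓ : Fin L) (t : ℕ) (h : Fin t → X ℓ) :
    {ω : World Θ X | history ℓ t ω = h} = {ω | pathPrefix t ω.2 ∈ historySet ℓ h} := by
  ext ω
  exact funext_iff

variable [MeasurableSpace Θ] [∀ ℓ, MeasurableSpace (X ℓ)]

theorem measurable_pathPrefix (t : ℕ) : Measurable (pathPrefix (X := X) t) :=
  measurable_pi_lambda _ fun _ => measurable_pi_apply _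

instance (S : InfoStructure Θ X) (θ : Θ) : IsProbabilityMeasure (S.lawGiven θ) := by
  unfold lawGiven; infer_instance

theorem law_real [Fintype Θ] (S : InfoStructure Θ X) (F : Set (World Θ X)) :
    S.law.real F = ∑ θ, (S.prior θ).toReal * (S.lawGiven θ).real F := by
  rw [law, measureReal_def, Measure.finsetSum_apply, ENNReal.toReal_sum]
  · simp [measureReal_def]
  · intro θ _
    exact ENNReal.mul_ne_top (S.prior.apply_ne_top θ) (measure_ne_top _ _)

variable [MeasurableSingletonClass Θ] [∀ ℓ, Fintype (X ℓ)] [∀ ℓ, MeasurableSingletonClass (X ℓ)]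

theorem measurableSet_prefixEvent [Fintype Θ] {t : ℕ} (A : Θ → Set (Fin t → ∀ ℓ, X ℓ)) :
    MeasurableSet {ω : World Θ X | pathPrefix t ω.2 ∈ A ω.1} := by
  have hm : Measurable fun ω : World Θ X => (ω.1, pathPrefix t ω.2) :=
    measurable_fst.prodMk ((measurable_pathPrefix t).comp measurable_snd)
  exact hm (MeasurableSet.of_discrete (s := {z : Θ × (Fin t → ∀ ℓ, X ℓ) | z.2 ∈ A z.1}))

/-- The bridge from the infinite product measure to finite sums. The set may depend on the state, so
it also covers events that restrict the state. -/
theorem lawGiven_prefixEvent [Fintype Θ] (S : InfoStructure Θ X) (θ : Θ) {t : ℕ}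
    (A : Θ → Set (Fin t → ∀ ℓ, X ℓ)) :
    (S.lawGiven θ).real {ω | pathPrefix t ω.2 ∈ A ω.1} = S.prob θ (A θ) := by
  classical
  set ν := Measure.infinitePi fun _ : ℕ => (S.signal θ).toMeasure with hν
  have h1 : (S.lawGiven θ).real {ω | pathPrefix t ω.2 ∈ A ω.1} =
      (ν.map (pathPrefix t)).real (A θ) := by
    rw [lawGiven, Measure.dirac_prod, map_measureReal_apply measurable_prodMk_left
      (measurableSet_prefixEvent A), map_measureReal_apply (measurable_pathPrefix t) .of_discrete]
    rfl
  have : IsProbabilityMeasure (ν.map (pathPrefix t)) :=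
    Measure.isProbabilityMeasure_map (measurable_pathPrefix t).aemeasurable
  have h2 : ∀ x : Fin t → ∀ ℓ, X ℓ,
      (ν.map (pathPrefix t)).real {x} = ∏ s, S.weight θ (x s) := by
    intro x
    rw [map_measureReal_apply (measurable_pathPrefix t) .of_discrete]
    -- The preimage of a single prefix is a cylinder: singletons before period `t`, no constraint
    -- afterwards.
    let u : ℕ → Set (∀ ℓ, X ℓ) := fun n => if hn : n < t then {x ⟨n, hn⟩} else Set.univ
    have hu : pathPrefix t ⁻¹' {x} = Set.pi (Finset.range t) u := by
      ext z
      simp only [Set.mem_preimage, Set.mem_singleton_iff, Set.mem_pi, Finset.coe_range,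
        Set.mem_Iio, u]
      refine ⟨fun hz n hn => ?_, fun hz => funext fun s => ?_⟩
      · simp [hn, ← hz, pathPrefix]
      · simpa [pathPrefix] using hz s s.2
    rw [hu, measureReal_def, hν, Measure.infinitePi_pi _ fun _ _ => .of_discrete,
      ENNReal.toReal_prod, Finset.prod_range]
    refine Finset.prod_congr rfl fun s _ => ?_
    simp [u, weight]
  rw [h1, prob]
  have h3 : A θ = ((Finset.univ.filter (· ∈ A θ) : Finset (Fin t → ∀ ℓ, X ℓ)) : Set _) := by
    ext; simp
  rw [h3, ← sum_measureReal_singleton, Finset.sum_filter]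
  refine Finset.sum_congr rfl fun x _ => ?_
  rw [h2]
  simp [Set.indicator_apply]

theorem law_history [Fintype Θ] (S : InfoStructure Θ X) (ℓ : Fin L) (t : ℕ) (h : Fin t → X ℓ) :
    S.law.real {ω | history ℓ t ω = h} =
      ∑ θ, (S.prior θ).toReal * ∏ s, S.freq θ ℓ (h s) := by
  simp only [law_real, setOf_history_eq, S.lawGiven_prefixEvent _ fun _ => historySet ℓ h,
    prob_historySet]

theorem measurableSet_history [Fintype Θ] (ℓ : Fin L) (t : ℕ) (h : Fin t → X ℓ) :
    MeasurableSet {ω : World Θ X | history ℓ t ω = h} := by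
  rw [setOf_history_eq]; exact measurableSet_prefixEvent fun _ => historySet ℓ h

theorem posterior_eq [Fintype Θ] (S : InfoStructure Θ X) (ℓ : Fin L) (t : ℕ)
    (F : Set (World Θ X)) (ω : World Θ X) :
    S.posterior ℓ t F ω = (S.law.real {ω' | history ℓ t ω' = history ℓ t ω})⁻¹ *
      S.law.real ({ω' | history ℓ t ω' = history ℓ t ω} ∩ F) := by
  rw [posterior, measureReal_def, cond_apply (measurableSet_history ℓ t _), ENNReal.toReal_mul,
    ENNReal.toReal_inv, measureReal_def, measureReal_def]

end InfoStructure
end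

/-! ### Commonly learned sets are commonly identified -/

noncomputable section

namespace InfoStructure

variable {Θ : Type*} {L : ℕ} {X : Fin L → Type*}

theorem commonlyIdentified_iff (S : InfoStructure Θ X) (Q : Set Θ) :
    S.CommonlyIdentified Q ↔
      ∀ ℓ, ∀ θ ∈ Q, ∀ θ', S.marginal θ ℓ = S.marginal θ' ℓ → θ' ∈ Q := by
  constructor
  · rintro ⟨C, hC, rfl⟩ ℓ θ ⟨c, hc, hθ⟩ θ' h
    obtain ⟨θ₀, rfl⟩ := hC hc
    refine ⟨_, hc, ?_⟩
    have hle : S.identification ℓ ≤ ⨆ ℓ, S.identification ℓ := le_iSup _ ℓ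
    exact Setoid.trans' _ (hle (show S.identification ℓ θ' θ from h.symm)) hθ
  · intro h
    -- The two-cell partition into `Q` and its complement is coarser than every identification
    -- partition, hence coarser than their join.
    have hle : (⨆ ℓ, S.identification ℓ) ≤ Setoid.ker (· ∈ Q) := by
      refine iSup_le fun ℓ θ θ' hθ => propext ⟨fun hm => ?_, fun hm => ?_⟩
      · exact h ℓ θ hm θ' hθ
      · exact h ℓ θ' hm θ (Eq.symm hθ)
    refine ⟨{c | c ∈ S.commonIdentification ∧ c ⊆ Q}, fun c hc => hc.1, ?_⟩
    ext θ
    refine ⟨fun hθ => ?_, fun ⟨c, hc, hθ⟩ => hc.2 hθ⟩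
    refine ⟨{θ' | (⨆ ℓ, S.identification ℓ) θ' θ}, ⟨⟨θ, rfl⟩, fun θ' hθ' => ?_⟩,
      Setoid.refl' (⨆ ℓ, S.identification ℓ) θ⟩
    have := hle hθ'
    exact (show (θ' ∈ Q) = (θ ∈ Q) from this).mpr hθ

variable [Fintype Θ] [MeasurableSpace Θ]
  [MeasurableSingletonClass Θ] [∀ ℓ, Fintype (X ℓ)] [∀ ℓ, MeasurableSpace (X ℓ)]
  [∀ ℓ, MeasurableSingletonClass (X ℓ)]

theorem lawGiven_history (S : InfoStructure Θ X) (θ : Θ) (ℓ : Fin L) (t : ℕ) (h : Fin t → X ℓ) :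
    (S.lawGiven θ).real {ω | history ℓ t ω = h} = ∏ s, S.freq θ ℓ (h s) := by
  rw [setOf_history_eq, S.lawGiven_prefixEvent _ fun _ => historySet ℓ h, prob_historySet]

theorem sum_law_history (S : InfoStructure Θ X) (ℓ : Fin L) (t : ℕ) :
    ∑ h, S.law.real {ω | history ℓ t ω = h} = 1 := by
  simp only [law_history]
  rw [Finset.sum_comm]
  simp only [← Finset.mul_sum, sum_pi_prod fun _ : Fin t => S.freq _ ℓ, sum_freq,
    Finset.prod_const_one, mul_one]
  exact S.prior.sum_toReal_eq_one

open scoped Classical in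
theorem law_history_inter_stateEvent (S : InfoStructure Θ X) (ℓ : Fin L) (t : ℕ)
    (h : Fin t → X ℓ) (Q : Set Θ) :
    S.law.real ({ω | history ℓ t ω = h} ∩ stateEvent X Q) =
      ∑ θ, if θ ∈ Q then (S.prior θ).toReal * ∏ s, S.freq θ ℓ (h s) else 0 := by
  have : {ω : World Θ X | history ℓ t ω = h} ∩ stateEvent X Q =
      {ω | pathPrefix t ω.2 ∈ if ω.1 ∈ Q then historySet ℓ h else ∅} := by
    rw [setOf_history_eq]
    ext ω
    by_cases hQ : ω.1 ∈ Q <;> simp [hQ, stateEvent]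
  rw [law_real, this]
  refine Finset.sum_congr rfl fun θ _ => ?_
  rw [S.lawGiven_prefixEvent θ fun θ => if θ ∈ Q then historySet ℓ h else ∅]
  split_ifs
  · rw [prob_historySet]
  · rw [prob_empty, mul_zero]

/-- The part of a history's probability that is due to a state outside of `Q`. -/
theorem prior_mul_add_law_le (S : InfoStructure Θ X) (ℓ : Fin L) (t : ℕ) (h : Fin t → X ℓ)
    {Q : Set Θ} {θ : Θ} (hθ : θ ∉ Q) :
    (S.prior θ).toReal * ∏ s, S.freq θ ℓ (h s) +
      S.law.real ({ω | history ℓ t ω = h} ∩ stateEvent X Q) ≤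
      S.law.real {ω | history ℓ t ω = h} := by
  classical
  have hnn : ∀ θ, 0 ≤ (S.prior θ).toReal * ∏ s, S.freq θ ℓ (h s) := fun θ =>
    mul_nonneg ENNReal.toReal_nonneg (Finset.prod_nonneg fun s _ => S.freq_nonneg _ _ _)
  rw [law_history_inter_stateEvent, law_history, ← Finset.add_sum_erase _ _ (Finset.mem_univ θ),
    ← Finset.add_sum_erase (a := θ) Finset.univ
      (fun θ => (S.prior θ).toReal * ∏ s, S.freq θ ℓ (h s)) (Finset.mem_univ θ), if_neg hθ,
    zero_add]
  gcongr with θ' _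
  split_ifs
  exacts [le_rfl, hnn θ']

theorem mul_law_le_of_mem_agentBelief (S : InfoStructure Θ X) {q : ℝ} {ℓ : Fin L} {t : ℕ}
    {F : Set (World Θ X)} {ω : World Θ X} (h : ω ∈ S.agentBelief q ℓ t F) :
    q * S.law.real {ω' | history ℓ t ω' = history ℓ t ω} ≤
      S.law.real ({ω' | history ℓ t ω' = history ℓ t ω} ∩ F) := by
  replace h : q ≤ S.posterior ℓ t F ω := h
  rw [posterior_eq] at h
  -- At a history of probability zero the left side vanishes, so no positivity hypothesis is needed.
  rcases measureReal_nonneg.eq_or_lt'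
    (a := S.law.real {ω' | history ℓ t ω' = history ℓ t ω}) with h0 | h0
  · rw [h0, mul_zero]; exact measureReal_nonneg
  · rwa [← div_eq_inv_mul, le_div_iff₀ h0] at h

theorem CommonlyLearned.mem_of_marginal_eq {S : InfoStructure Θ X} {Q : Set Θ}
    (hQ : S.CommonlyLearned Q) {ℓ : Fin L} {θ θ' : Θ} (hθ : θ ∈ Q)
    (heq : S.marginal θ ℓ = S.marginal θ' ℓ) : θ' ∈ Q := by
  classical
  by_contra hθ'
  set p := (S.prior θ').toReal with hp
  have hp0 : 0 < p := S.prior_toReal_pos θ'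
  -- This `q` solves p * q = 1 - q, the threshold at which the averaging argument breaks.
  obtain ⟨T, F, -, hF⟩ := hQ (1 / (1 + p))
    ⟨by positivity, by rw [div_lt_one (by positivity)]; linarith⟩
  set q := 1 / (1 + p) with hq
  obtain ⟨hB, hlt, -⟩ := hF T le_rfl θ hθ
  -- The event `F T` may depend on the state and on other agents' signals, so it is enlarged to ℓ's
  -- histories occurring in it; their probability is the same under θ and θ'.
  set 𝓗 : Finset (Fin T → X ℓ) := Finset.univ.filter (· ∈ history ℓ T '' F T)
  have h1 : q < ∑ h ∈ 𝓗, ∏ s, S.freq θ' ℓ (h s) := by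
    refine hlt.trans_le ?_
    have hsub : F T ⊆ ⋃ h ∈ 𝓗, {ω : World Θ X | history ℓ T ω = h} := fun ω hω => by
      simp only [Set.mem_iUnion]
      exact ⟨history ℓ T ω, by simpa [𝓗] using ⟨_, _, hω, rfl⟩, rfl⟩
    refine (measureReal_mono hsub (measure_ne_top _ _)).trans ((measureReal_biUnion_finset_le _ _).trans_eq ?_)
    refine Finset.sum_congr rfl fun h _ => ?_
    rw [lawGiven_history]
    simp only [freq, heq]
  have h2 : ∀ h ∈ 𝓗, p * ∏ s, S.freq θ' ℓ (h s) ≤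
      (1 - q) * S.law.real {ω | history ℓ T ω = h} := by
    intro h hh
    obtain ⟨ω, hω, rfl⟩ := (Finset.mem_filter.1 hh).2
    have h3 := S.mul_law_le_of_mem_agentBelief (Set.mem_iInter.1 (hB hω) ℓ)
    have h4 := S.prior_mul_add_law_le ℓ T (history ℓ T ω) hθ'
    linarith
  have hq1 : 0 ≤ 1 - q := by
    rw [hq, sub_nonneg, div_le_one (by positivity)]; linarith
  have h5 : p * ∑ h ∈ 𝓗, ∏ s, S.freq θ' ℓ (h s) ≤ 1 - q := by
    rw [Finset.mul_sum]
    refine (Finset.sum_le_sum h2).trans ?_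
    rw [← Finset.mul_sum]
    refine mul_le_of_le_one_right hq1 ?_
    rw [← S.sum_law_history ℓ T]
    exact Finset.sum_le_sum_of_subset_of_nonneg (Finset.subset_univ _)
      fun _ _ _ => measureReal_nonneg
  have h6 : p * q = 1 - q := by rw [hq]; field_simp; ring
  have h7 := mul_lt_mul_of_pos_left h1 hp0
  linarith

end InfoStructure
end

/-! ### Empirical counts: contraction and likelihood ratios -/

noncomputable section

namespace InfoStructure

variable {Θ : Type*} {L : ℕ} {X : Fin L → Type*}

theorem pairFreq_nonneg (S : InfoStructure Θ X) (θ : Θ) (ℓ ℓ' : Fin L) (a : X ℓ) (b : X ℓ') :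
    0 ≤ S.pairFreq θ ℓ ℓ' a b := ENNReal.toReal_nonneg

/-- The conditional probability of agent `ℓ'`'s signal `b` given agent `ℓ`'s signal `a`. -/
def condFreq (S : InfoStructure Θ X) (θ : Θ) (ℓ ℓ' : Fin L) (a : X ℓ) (b : X ℓ') : ℝ :=
  S.pairFreq θ ℓ ℓ' a b / S.freq θ ℓ a

theorem condFreq_nonneg (S : InfoStructure Θ X) (θ : Θ) (ℓ ℓ' : Fin L) (a : X ℓ) (b : X ℓ') :
    0 ≤ S.condFreq θ ℓ ℓ' a b := div_nonneg (S.pairFreq_nonneg _ _ _ _ _) (S.freq_nonneg _ _ _)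

variable [∀ ℓ, Fintype (X ℓ)]

open scoped Classical in
/-- The number of occurrences of `a` in `h`. -/
def count {α : Type*} {t : ℕ} (h : Fin t → α) (a : α) : ℝ := ∑ s, if h s = a then 1 else 0

theorem sum_count_mul {α : Type*} [Fintype α] {t : ℕ} (h : Fin t → α) (f : α → ℝ) :
    ∑ a, count h a * f a = ∑ s, f (h s) := by
  classical
  simp only [count, Finset.sum_mul]
  rw [Finset.sum_comm]
  simp

theorem sum_count {α : Type*} [Fintype α] {t : ℕ} (h : Fin t → α) : ∑ a, count h a = t := by
  simpa using sum_count_mul h fun _ => 1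

/-- The distance, scaled by `t`, of the empirical distribution of a history of agent `ℓ` from the
signal distribution in state `θ`. -/
def deviation (S : InfoStructure Θ X) (θ : Θ) (ℓ : Fin L) {t : ℕ} (h : Fin t → X ℓ) : ℝ :=
  ∑ a, |count h a - t * S.freq θ ℓ a|

theorem sum_mul_le_deviation_mul (S : InfoStructure Θ X) (θ : Θ) (ℓ : Fin L) {t : ℕ}
    (h : Fin t → X ℓ) (g : X ℓ → ℝ) :
    ∑ s, g (h s) ≤ t * ∑ a, S.freq θ ℓ a * g a + S.deviation θ ℓ h * ∑ a, |g a| := by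
  have h1 : ∑ s, g (h s) = t * ∑ a, S.freq θ ℓ a * g a +
      ∑ a, (count h a - t * S.freq θ ℓ a) * g a := by
    rw [← sum_count_mul h g, Finset.mul_sum, ← Finset.sum_add_distrib]
    exact Finset.sum_congr rfl fun a _ => by ring
  rw [h1, deviation, Finset.sum_mul]
  refine add_le_add_right (Finset.sum_le_sum fun a _ => ?_) _
  refine (le_abs_self _).trans ?_
  rw [abs_mul]
  gcongr
  exact Finset.single_le_sum (f := fun a => |g a|) (fun _ _ => abs_nonneg _) (Finset.mem_univ a)

theorem sum_pairFreq_left (S : InfoStructure Θ X) (θ : Θ) (ℓ ℓ' : Fin L) (b : X ℓ') :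
    ∑ a, S.pairFreq θ ℓ ℓ' a b = S.freq θ ℓ' b := by
  classical
  simp only [pairFreq_eq, freq_eq]
  rw [Finset.sum_comm]
  simp [ite_and]

theorem sum_pairFreq_right (S : InfoStructure Θ X) (θ : Θ) (ℓ ℓ' : Fin L) (a : X ℓ) :
    ∑ b, S.pairFreq θ ℓ ℓ' a b = S.freq θ ℓ a := by
  classical
  simp only [pairFreq_eq, freq_eq]
  rw [Finset.sum_comm]
  simp [ite_and]

theorem pairFreq_le_freq (S : InfoStructure Θ X) (θ : Θ) (ℓ ℓ' : Fin L) (a : X ℓ) (b : X ℓ') :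
    S.pairFreq θ ℓ ℓ' a b ≤ S.freq θ ℓ a := by
  rw [← S.sum_pairFreq_right θ ℓ ℓ' a]
  exact Finset.single_le_sum (f := fun b => S.pairFreq θ ℓ ℓ' a b)
    (fun _ _ => S.pairFreq_nonneg _ _ _ _ _) (Finset.mem_univ b)

theorem condFreq_le_one (S : InfoStructure Θ X) (θ : Θ) (ℓ ℓ' : Fin L) (a : X ℓ) (b : X ℓ') :
    S.condFreq θ ℓ ℓ' a b ≤ 1 :=
  div_le_one_of_le₀ (S.pairFreq_le_freq _ _ _ _ _) (S.freq_nonneg _ _ _)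

/-- Conditional expectations of another agent's signal counts contract deviations from the signal
distributions. -/
theorem sum_abs_condFreq_le (S : InfoStructure Θ X) (θ : Θ) {ℓ ℓ' : Fin L} {m : ℝ} (hm : 0 < m)
    (hpair : ∀ a b, m ≤ S.pairFreq θ ℓ ℓ' a b) {t : ℕ} (h : Fin t → X ℓ) :
    ∑ b, |∑ s, S.condFreq θ ℓ ℓ' (h s) b - t * S.freq θ ℓ' b| ≤
      (1 - m) * S.deviation θ ℓ h := by
  have hne : Nonempty (X ℓ') := by
    by_contra hemp
    rw [not_nonempty_iff] at hemp
    simpa using S.sum_freq θ ℓ'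
  obtain ⟨b₀⟩ := hne
  have hpos : ∀ a, 0 < S.freq θ ℓ a := fun a =>
    hm.trans_le ((hpair a b₀).trans (S.pairFreq_le_freq _ _ _ _ _))
  have hcond : ∀ a b, 0 ≤ S.condFreq θ ℓ ℓ' a b - m := fun a b => by
    rw [sub_nonneg, condFreq, le_div_iff₀ (hpos a)]
    exact (mul_le_of_le_one_right hm.le (S.freq_le_one _ _ _)).trans (hpair a b)
  -- Subtracting m from every entry removes at least m from each row sum, as there is at least one
  -- column.
  have hsum : ∀ a, ∑ b, (S.condFreq θ ℓ ℓ' a b - m) ≤ 1 - m := fun a => by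
    rw [Finset.sum_sub_distrib]
    simp only [condFreq]
    rw [← Finset.sum_div, sum_pairFreq_right, div_self (hpos a).ne']
    have : m ≤ ∑ _b : X ℓ', m :=
      Finset.single_le_sum (f := fun _ : X ℓ' => m) (fun _ _ => hm.le) (Finset.mem_univ b₀)
    linarith
  have hzero : ∑ a, (count h a - t * S.freq θ ℓ a) = 0 := by
    rw [Finset.sum_sub_distrib, sum_count, ← Finset.mul_sum, sum_freq, mul_one, sub_self]
  -- Subtracting the constant m from the matrix changes nothing because the count deviations sum to
  -- zero; this is the Doeblin contraction argument.
  have hexp : ∀ b, ∑ s, S.condFreq θ ℓ ℓ' (h s) b - t * S.freq θ ℓ' b =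
      ∑ a, (count h a - t * S.freq θ ℓ a) * (S.condFreq θ ℓ ℓ' a b - m) := fun b => by
    simp only [mul_sub, Finset.sum_sub_distrib]
    rw [← Finset.sum_mul, hzero, zero_mul, sub_zero]
    simp only [sub_mul, Finset.sum_sub_distrib]
    rw [sum_count_mul h fun a => S.condFreq θ ℓ ℓ' a b, ← S.sum_pairFreq_left θ ℓ ℓ' b,
      Finset.mul_sum]
    congr 1
    refine Finset.sum_congr rfl fun a _ => ?_
    rw [condFreq, mul_assoc, mul_div_cancel₀ _ (hpos a).ne']
  calc ∑ b, |∑ s, S.condFreq θ ℓ ℓ' (h s) b - t * S.freq θ ℓ' b|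
      ≤ ∑ b, ∑ a, |count h a - t * S.freq θ ℓ a| * (S.condFreq θ ℓ ℓ' a b - m) := by
        refine Finset.sum_le_sum fun b _ => ?_
        rw [hexp]
        refine (Finset.abs_sum_le_sum_abs _ _).trans_eq ?_
        exact Finset.sum_congr rfl fun a _ => by rw [abs_mul, abs_of_nonneg (hcond a b)]
    _ = ∑ a, |count h a - t * S.freq θ ℓ a| * ∑ b, (S.condFreq θ ℓ ℓ' a b - m) := by
        rw [Finset.sum_comm]
        simp only [Finset.mul_sum]
    _ ≤ ∑ a, |count h a - t * S.freq θ ℓ a| * (1 - m) := by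
        gcongr with a _
        exact hsum a
    _ = _ := by rw [← Finset.sum_mul, deviation, mul_comm]

/-- Histories close to the signal distribution in `θ` have exponentially small likelihood ratio in
every state with another signal distribution. -/
theorem exists_prod_freq_le (S : InfoStructure Θ X) {θ θ' : Θ} {ℓ : Fin L}
    (hne : S.marginal θ ℓ ≠ S.marginal θ' ℓ) :
    ∃ c > 0, ∀ δ : ℝ, 0 < δ → δ ≤ c → ∀ (t : ℕ) (h : Fin t → X ℓ),
      (∀ s, S.freq θ ℓ (h s) ≠ 0) → S.deviation θ ℓ h ≤ t * δ →
      ∏ s, S.freq θ' ℓ (h s) ≤ Real.exp (-(t * δ)) * ∏ s, S.freq θ ℓ (h s) := by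
  set φ := S.freq θ ℓ with hφ
  set φ' := S.freq θ' ℓ with hφ'
  have h0 : ∀ a, 0 ≤ φ a := S.freq_nonneg θ ℓ
  have h0' : ∀ a, 0 ≤ φ' a := S.freq_nonneg θ' ℓ
  -- Replaces the log-likelihood ratio via log x ≤ 2(√x - 1), which stays finite when φ' vanishes.
  -- The φ-mean of 2g is bounded by minus the squared Hellinger-type distance ρ.
  set g : X ℓ → ℝ := fun a => √(φ' a / φ a) - 1 with hg
  set B := ∑ a, |g a| with hB
  have hB0 : 0 ≤ B := Finset.sum_nonneg fun a _ => abs_nonneg _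
  set ρ := ∑ a, (√(φ a) - √(φ' a)) ^ 2 with hρ
  have hρ0 : 0 < ρ := by
    obtain ⟨a, ha⟩ : ∃ a, φ a ≠ φ' a := by
      by_contra! hall
      refine hne (PMF.ext fun a => ?_)
      exact (ENNReal.toReal_eq_toReal_iff' (PMF.apply_ne_top _ _) (PMF.apply_ne_top _ _)).1 (hall a)
    refine Finset.sum_pos' (fun a _ => sq_nonneg _) ⟨a, Finset.mem_univ a, ?_⟩
    have : √(φ a) ≠ √(φ' a) := fun h => ha ((Real.sqrt_inj (h0 a) (h0' a)).1 h)
    exact sq_pos_of_ne_zero (sub_ne_zero.2 this)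
  have hφg : 2 * ∑ a, φ a * g a ≤ -ρ := by
    have h1 : ∀ a, 2 * (φ a * g a) ≤ φ' a - φ a - (√(φ a) - √(φ' a)) ^ 2 := by
      intro a
      have e1 := Real.sq_sqrt (h0 a)
      have e2 := Real.sq_sqrt (h0' a)
      have e3 : φ a * √(φ' a / φ a) ≤ √(φ a) * √(φ' a) := by
        rcases (h0 a).eq_or_lt with h | h
        · rw [← h]; simp
        · rw [Real.sqrt_div (h0' a)]
          apply le_of_eq
          have : √(φ a) ≠ 0 := (Real.sqrt_pos.2 h).ne'
          field_simp
          rw [e1, mul_comm]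
      simp only [hg]
      nlinarith
    calc 2 * ∑ a, φ a * g a ≤ ∑ a, (φ' a - φ a - (√(φ a) - √(φ' a)) ^ 2) := by
          rw [Finset.mul_sum]; exact Finset.sum_le_sum fun a _ => h1 a
      _ = -ρ := by
          rw [Finset.sum_sub_distrib, Finset.sum_sub_distrib, sum_freq, sum_freq]; ring
  -- The total exponent is at most t(-ρ + 2Bδ), which is at most -tδ exactly when δ(2B + 1) ≤ ρ (for
  -- t > 0).
  refine ⟨ρ / (2 * B + 1), by positivity, fun δ hδ hδc t h hsupp hdev => ?_⟩
  rw [le_div_iff₀ (by positivity)] at hδc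
  have hpt : ∀ s, φ' (h s) ≤ Real.exp (2 * g (h s)) * φ (h s) := by
    intro s
    have hp : 0 < φ (h s) := lt_of_le_of_ne (h0 _) (hsupp s).symm
    rw [← div_le_iff₀ hp]
    have h1 : √(φ' (h s) / φ (h s)) ≤ Real.exp (g (h s)) := by
      have := Real.add_one_le_exp (g (h s))
      simpa [hg] using this
    calc φ' (h s) / φ (h s) = √(φ' (h s) / φ (h s)) ^ 2 :=
          (Real.sq_sqrt (div_nonneg (h0' _) (h0 _))).symm
      _ ≤ Real.exp (g (h s)) ^ 2 := by gcongr
      _ = Real.exp (2 * g (h s)) := by rw [← Real.exp_nat_mul]; norm_num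
  calc ∏ s, φ' (h s) ≤ ∏ s, Real.exp (2 * g (h s)) * φ (h s) :=
        Finset.prod_le_prod (fun s _ => h0' _) fun s _ => hpt s
    _ = Real.exp (2 * ∑ s, g (h s)) * ∏ s, φ (h s) := by
        rw [Finset.prod_mul_distrib, ← Real.exp_sum, Finset.mul_sum]
    _ ≤ _ := by
        refine mul_le_mul_of_nonneg_right (Real.exp_le_exp.2 ?_)
          (Finset.prod_nonneg fun s _ => h0 _)
        have h1 := S.sum_mul_le_deviation_mul θ ℓ h g
        have h2 := mul_le_mul_of_nonneg_right hdev hB0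
        have h3 := mul_le_mul_of_nonneg_left hφg (Nat.cast_nonneg (α := ℝ) t)
        have h4 := mul_le_mul_of_nonneg_left hδc (Nat.cast_nonneg (α := ℝ) t)
        linarith

end InfoStructure
end

/-! ### Typical sets and their conditional probability -/

noncomputable section

namespace InfoStructure

variable {Θ : Type*} {L : ℕ} {X : Fin L → Type*} [∀ ℓ, Fintype (X ℓ)]

/-- A union bound in which paths of zero weight need not be covered; this disposes of the support
clause in `typicalSet`. -/
theorem prob_le_sum (S : InfoStructure Θ X) (θ : Θ) {t : ℕ} {ι : Type*} (I : Finset ι)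
    (A : Set (Fin t → ∀ ℓ, X ℓ)) (B : ι → Set (Fin t → ∀ ℓ, X ℓ))
    (hAB : ∀ x ∈ A, (∀ s, S.weight θ (x s) ≠ 0) → ∃ i ∈ I, x ∈ B i) :
    S.prob θ A ≤ ∑ i ∈ I, S.prob θ (B i) := by
  simp only [prob]
  rw [Finset.sum_comm]
  refine Finset.sum_le_sum fun x _ => ?_
  have hnn : ∀ i ∈ I, 0 ≤ (B i).indicator (fun x => ∏ s, S.weight θ (x s)) x := fun i _ =>
    Set.indicator_nonneg (fun x _ => S.prod_weight_nonneg θ x) _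
  refine Set.indicator_apply_le' (fun hx => ?_) fun _ => Finset.sum_nonneg hnn
  by_cases h0 : ∏ s, S.weight θ (x s) = 0
  · rw [h0]; exact Finset.sum_nonneg hnn
  · obtain ⟨i, hi, hxi⟩ := hAB x hx fun s => Finset.prod_ne_zero_iff.1 h0 s (Finset.mem_univ s)
    refine le_trans ?_ (Finset.single_le_sum hnn hi)
    rw [Set.indicator_of_mem hxi]

theorem prob_add_prob_compl_inter (S : InfoStructure Θ X) (θ : Θ) {t : ℕ}
    (A H : Set (Fin t → ∀ ℓ, X ℓ)) : S.prob θ (A ∩ H) + S.prob θ (Aᶜ ∩ H) = S.prob θ H := by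
  classical
  simp only [prob]
  rw [← Finset.sum_add_distrib]
  refine Finset.sum_congr rfl fun x _ => ?_
  by_cases hA : x ∈ A <;> by_cases hH : x ∈ H <;> simp [hA, hH]

/-- Prefixes in which every agent's signals are possible in state `θ` and have nearly the
frequencies predicted by `θ`. -/
def typicalSet (S : InfoStructure Θ X) (δ : ℝ) (θ : Θ) (t : ℕ) : Set (Fin t → ∀ ℓ, X ℓ) :=
  {x | ∀ ℓ, (∀ s, S.freq θ ℓ (x s ℓ) ≠ 0) ∧ S.deviation θ ℓ (fun s => x s ℓ) ≤ t * δ}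

theorem freq_ne_zero_of_weight_ne_zero (S : InfoStructure Θ X) {θ : Θ} {y : ∀ ℓ, X ℓ}
    (hy : S.weight θ y ≠ 0) (ℓ : Fin L) : S.freq θ ℓ (y ℓ) ≠ 0 :=
  ((lt_of_le_of_ne (S.weight_nonneg θ y) hy.symm).trans_le (S.weight_le_freq θ ℓ y)).ne'

/-- If the deviation is large although the expected counts `e` are good, some count is far from
its expectation. -/
theorem exists_le_abs_of_lt_deviation (S : InfoStructure Θ X) (θ : Θ) (ℓ : Fin L) {t : ℕ}
    (h : Fin t → X ℓ) (e : X ℓ → ℝ) {η r δ : ℝ}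
    (he : ∑ b, |e b - t * S.freq θ ℓ b| ≤ t * r) (hη : η * Fintype.card (X ℓ) ≤ δ - r)
    (hdev : t * δ < S.deviation θ ℓ h) : ∃ b, t * η ≤ |count h b - e b| := by
  by_contra! hall
  have h1 : S.deviation θ ℓ h ≤ ∑ b, (t * η + |e b - t * S.freq θ ℓ b|) := by
    refine Finset.sum_le_sum fun b _ => ?_
    refine (abs_sub_le _ (e b) _).trans ?_
    gcongr
    exact (hall b).le
  rw [Finset.sum_add_distrib, Finset.sum_const, Finset.card_univ, nsmul_eq_mul] at h1
  have h2 := mul_le_mul_of_nonneg_left hη (Nat.cast_nonneg (α := ℝ) t)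
  linarith

theorem card_le_card_sigma (ℓ : Fin L) : Fintype.card (X ℓ) ≤ Fintype.card (Σ ℓ, X ℓ) :=
  Fintype.card_le_of_injective (fun a => (⟨ℓ, a⟩ : Σ ℓ, X ℓ)) sigma_mk_injective

theorem sum_le_card_mul {ι : Type*} [Fintype ι] (I : Finset ι) (f : ι → ℝ) {c : ℝ} (hc : 0 ≤ c)
    (hf : ∀ i ∈ I, f i ≤ c) : ∑ i ∈ I, f i ≤ Fintype.card ι * c := by
  refine (Finset.sum_le_card_nsmul I f c hf).trans ?_
  rw [nsmul_eq_mul]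
  gcongr
  exact Finset.card_le_univ I

theorem abs_ite_sub_le_one {P : Prop} [Decidable P] {p : ℝ} (h0 : 0 ≤ p) (h1 : p ≤ 1) :
    |(if P then 1 else 0) - p| ≤ 1 := by
  split_ifs <;> rw [abs_le] <;> constructor <;> linarith

/-- The typical set has high probability. -/
theorem prob_compl_typicalSet_le (S : InfoStructure Θ X) (θ : Θ) (t : ℕ) {δ η : ℝ} (hη : 0 ≤ η)
    (hη2 : η ≤ 2) (hηδ : η * Fintype.card (Σ ℓ, X ℓ) ≤ δ) :
    S.prob θ (S.typicalSet δ θ t)ᶜ ≤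
      Fintype.card (Σ ℓ, X ℓ) * (2 * Real.exp (-(t * (η ^ 2 / 4)))) := by
  classical
  let g : (Σ ℓ, X ℓ) → (∀ ℓ, X ℓ) → ℝ :=
    fun i y => (if y i.1 = i.2 then 1 else 0) - S.freq θ i.1 i.2
  let B : (Σ ℓ, X ℓ) → Set (Fin t → ∀ ℓ, X ℓ) := fun i => {x | t * η ≤ |∑ s, g i (x s)|}
  refine (S.prob_le_sum θ Finset.univ _ B fun x hx hw => ?_).trans
    (sum_le_card_mul _ _ (by positivity) fun i _ => ?_)
  · obtain ⟨ℓ, hℓ⟩ := not_forall.1 hx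
    have hdev : t * δ < S.deviation θ ℓ fun s => x s ℓ := by
      by_contra hcon
      exact hℓ ⟨fun s => S.freq_ne_zero_of_weight_ne_zero (hw s) ℓ, not_lt.1 hcon⟩
    -- Unconditionally the expected counts are exact, so their error r is 0 and all of δ is
    -- available for fluctuations.
    have hη' : η * Fintype.card (X ℓ) ≤ δ - 0 := by
      rw [sub_zero]
      refine le_trans ?_ hηδ
      gcongr
      exact card_le_card_sigma ℓ
    obtain ⟨b, hb⟩ := S.exists_le_abs_of_lt_deviation θ ℓ _ (fun b => t * S.freq θ ℓ b)
      (by simp) hη' hdev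
    refine ⟨⟨ℓ, b⟩, Finset.mem_univ _, ?_⟩
    simpa [B, g, count, Finset.sum_sub_distrib] using hb
  · have := chernoff (t := t) (fun _ => S.weight θ) (fun _ => g i) (fun _ => S.weight_nonneg θ)
      (fun _ y => abs_ite_sub_le_one (S.freq_nonneg _ _ _) (S.freq_le_one _ _ _))
      (fun _ => ?_) hη hη2
    · simpa [sum_weight, prob, B] using this
    · simp only [g, mul_sub, Finset.sum_sub_distrib]
      rw [← Finset.sum_mul, sum_weight, one_mul, freq_eq]
      simp

/-- Given a typical history of one agent, the typical set has high conditional probability. -/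
theorem prob_compl_typicalSet_inter_le (S : InfoStructure Θ X) (θ : Θ) {ℓ : Fin L} {t : ℕ}
    (h : Fin t → X ℓ) {m δ η : ℝ} (hm : 0 < m)
    (hpair : ∀ ℓ', ℓ ≠ ℓ' → ∀ a b, m ≤ S.pairFreq θ ℓ ℓ' a b) (hm1 : m ≤ 1)
    (hη : 0 ≤ η) (hη2 : η ≤ 2) (hηδ : η * Fintype.card (Σ ℓ, X ℓ) ≤ m * δ)
    (hsupp : ∀ s, S.freq θ ℓ (h s) ≠ 0) (hdev : S.deviation θ ℓ h ≤ t * δ) :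
    S.prob θ ((S.typicalSet δ θ t)ᶜ ∩ historySet ℓ h) ≤
      Fintype.card (Σ ℓ, X ℓ) * (2 * Real.exp (-(t * (η ^ 2 / 4))) *
        S.prob θ (historySet ℓ h)) := by
  classical
  let g : (Σ ℓ, X ℓ) → Fin t → (∀ ℓ, X ℓ) → ℝ :=
    fun i s y => (if y i.1 = i.2 then 1 else 0) - S.condFreq θ ℓ i.1 (h s) i.2
  let B : (Σ ℓ, X ℓ) → Set (Fin t → ∀ ℓ, X ℓ) :=
    fun i => {x | t * η ≤ |∑ s, g i s (x s)|} ∩ historySet ℓ h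
  refine (S.prob_le_sum θ Finset.univ _ B fun x hx hw => ?_).trans
    (sum_le_card_mul _ _ (mul_nonneg (by positivity) (S.prob_nonneg _ _)) fun i _ => ?_)
  · obtain ⟨ℓ', hℓ'⟩ := not_forall.1 hx.1
    have hdev' : t * δ < S.deviation θ ℓ' fun s => x s ℓ' := by
      by_contra hcon
      exact hℓ' ⟨fun s => S.freq_ne_zero_of_weight_ne_zero (hw s) ℓ', not_lt.1 hcon⟩
    -- The history of ℓ itself is typical by assumption, so only another agent can deviate; full
    -- support is therefore needed for distinct agents only.
    have hne : ℓ ≠ ℓ' := by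
      rintro rfl
      have hxh : (fun s => x s ℓ) = h := funext hx.2
      rw [hxh] at hdev'
      exact hdev.not_gt hdev'
    have hη' : η * Fintype.card (X ℓ') ≤ δ - (1 - m) * δ := by
      have : η * Fintype.card (X ℓ') ≤ m * δ := by
        refine le_trans ?_ hηδ
        gcongr
        exact card_le_card_sigma ℓ'
      linarith
    have hcontr : ∑ b, |∑ s, S.condFreq θ ℓ ℓ' (h s) b - t * S.freq θ ℓ' b| ≤
        t * ((1 - m) * δ) := by
      refine (S.sum_abs_condFreq_le θ hm (hpair ℓ' hne) h).trans ?_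
      have := mul_le_mul_of_nonneg_left hdev (sub_nonneg.2 hm1)
      linarith
    obtain ⟨b, hb⟩ := S.exists_le_abs_of_lt_deviation θ ℓ' _ _ hcontr hη' hdev'
    refine ⟨⟨ℓ', b⟩, Finset.mem_univ _, ?_, hx.2⟩
    simpa [B, g, count, Finset.sum_sub_distrib] using hb
  -- The restricted weights have total mass ∏ φ(h s), the probability of the history, so the bound
  -- is relative to that probability. Centring at `condFreq` makes each period's restricted mean
  -- zero.
  · have := chernoff (fun s y => if y ℓ = h s then S.weight θ y else 0) (g i)
      (fun s y => by
        split_ifs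
        exacts [S.weight_nonneg θ y, le_rfl])
      (fun s y => abs_ite_sub_le_one (S.condFreq_nonneg _ _ _ _ _) (S.condFreq_le_one _ _ _ _ _))
      (fun s => ?_) hη hη2
    · rw [prob_inter_historySet, prob_historySet]
      simpa only [freq_eq] using this
    · simp only [g, mul_sub, Finset.sum_sub_distrib]
      rw [← Finset.sum_mul, ← freq_eq, condFreq, mul_div_cancel₀ _ (hsupp s), pairFreq_eq,
        sub_eq_zero]
      refine Finset.sum_congr rfl fun y _ => ?_
      rw [ite_and]
      split_ifs <;> simp

end InfoStructure
end

/-! ### Commonly identified sets are commonly learned -/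

noncomputable section

namespace InfoStructure

open Filter Topology

variable {Θ : Type*} {L : ℕ} {X : Fin L → Type*}

theorem PairwiseFullSupport.exists_le_pairFreq [Finite Θ] [∀ ℓ, Finite (X ℓ)]
    {S : InfoStructure Θ X} (hS : S.PairwiseFullSupport) :
    ∃ m, 0 < m ∧ m ≤ 1 ∧ ∀ θ ℓ ℓ', ℓ ≠ ℓ' → ∀ a b, m ≤ S.pairFreq θ ℓ ℓ' a b := by
  have key : ∀ᶠ m in 𝓝[>] (0 : ℝ), ∀ θ ℓ ℓ', ∀ a b, ℓ ≠ ℓ' → m ≤ S.pairFreq θ ℓ ℓ' a b := by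
    simp only [eventually_all]
    intro θ ℓ ℓ' a b hne
    have hpos : 0 < S.pairFreq θ ℓ ℓ' a b :=
      ENNReal.toReal_pos (hS θ ℓ ℓ' hne a b).ne' (PMF.apply_ne_top _ _)
    filter_upwards [Ioo_mem_nhdsGT hpos] with m hm using hm.2.le
  have h1 : ∀ᶠ m in 𝓝[>] (0 : ℝ), m ∈ Set.Ioo 0 1 := Ioo_mem_nhdsGT one_pos
  obtain ⟨m, hm, hm1⟩ := (key.and h1).exists
  exact ⟨m, hm1.1, hm1.2.le, fun θ ℓ ℓ' hne a b => hm θ ℓ ℓ' a b hne⟩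

/-- There are finitely many agents and states, and each bound holds for all small δ, so a single δ
serves them all. -/
theorem exists_uniform_prod_freq_le [Finite Θ] [∀ ℓ, Fintype (X ℓ)] (S : InfoStructure Θ X) :
    ∃ δ > 0, ∀ ℓ θ θ', S.marginal θ ℓ ≠ S.marginal θ' ℓ → ∀ (t : ℕ) (h : Fin t → X ℓ),
      (∀ s, S.freq θ ℓ (h s) ≠ 0) → S.deviation θ ℓ h ≤ t * δ →
      ∏ s, S.freq θ' ℓ (h s) ≤ Real.exp (-(t * δ)) * ∏ s, S.freq θ ℓ (h s) := by
  have key : ∀ᶠ δ in 𝓝[>] (0 : ℝ), ∀ ℓ θ θ', S.marginal θ ℓ ≠ S.marginal θ' ℓ →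
      ∀ (t : ℕ) (h : Fin t → X ℓ), (∀ s, S.freq θ ℓ (h s) ≠ 0) → S.deviation θ ℓ h ≤ t * δ →
      ∏ s, S.freq θ' ℓ (h s) ≤ Real.exp (-(t * δ)) * ∏ s, S.freq θ ℓ (h s) := by
    rw [eventually_all]; intro ℓ
    rw [eventually_all]; intro θ
    rw [eventually_all]; intro θ'
    by_cases hne : S.marginal θ ℓ = S.marginal θ' ℓ
    · exact Eventually.of_forall fun _ h => absurd hne h
    · obtain ⟨c, hc, h⟩ := S.exists_prod_freq_le hne
      filter_upwards [Ioo_mem_nhdsGT hc] with δ hδ _ using h δ hδ.1 hδ.2.le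
  obtain ⟨δ, hδ, hpos⟩ := (key.and self_mem_nhdsWithin).exists
  exact ⟨δ, hpos, hδ⟩

theorem eventually_mul_exp_le (c : ℝ) {κ ε : ℝ} (hκ : 0 < κ) (hε : 0 < ε) :
    ∀ᶠ t : ℕ in atTop, c * Real.exp (-(t * κ)) ≤ ε := by
  have h1 : Tendsto (fun t : ℕ => c * Real.exp (-(t * κ))) atTop (𝓝 (c * 0)) := by
    refine Tendsto.const_mul _ (Real.tendsto_exp_neg_atTop_nhds_zero.comp ?_)
    exact tendsto_natCast_atTop_atTop.atTop_mul_const hκ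
  rw [mul_zero] at h1
  exact (h1.eventually (gt_mem_nhds hε)).mono fun _ h => h.le

/-- If a history has high conditional probability of `G` in every state that agrees with `θ₀`, and
low likelihood in all others, then the posterior probability of `G` is high. -/
theorem mul_sum_le_sum_of_posterior_odds {ι : Type*} [Fintype ι] (C : Set ι) {i₀ : ι}
    (hi₀ : i₀ ∈ C) (p a b : ι → ℝ) (hp : ∀ i, 0 ≤ p i) (hp1 : ∑ i, p i = 1)
    (ha : ∀ i, 0 ≤ a i) (hb : ∀ i, 0 ≤ b i) {ε ε' q : ℝ} (hq0 : 0 ≤ q) (hq1 : q ≤ 1) (hε : 0 ≤ ε)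
    (hq : q + 2 * ε ≤ 1) (hε' : ε' ≤ ε * p i₀) (hε'0 : 0 ≤ ε')
    (hC : ∀ i ∈ C, (1 - ε) * a i ≤ b i) (hCc : ∀ i ∉ C, a i ≤ ε' * a i₀) :
    q * ∑ i, p i * a i ≤ ∑ i, p i * b i := by
  classical
  set A := ∑ i, if i ∈ C then p i * a i else 0 with hA
  have h0 : p i₀ * a i₀ ≤ A := by
    refine le_trans (by simp [hi₀]) (Finset.single_le_sum (f := fun i => if i ∈ C then p i * a i
      else 0) (fun i _ => ?_) (Finset.mem_univ i₀))
    split_ifs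
    exacts [mul_nonneg (hp i) (ha i), le_rfl]
  have hA0 : 0 ≤ A := (mul_nonneg (hp _) (ha _)).trans h0
  have h1 : ∑ i, p i * a i ≤ A + ε' * a i₀ := by
    have : ∀ i, p i * a i ≤ (if i ∈ C then p i * a i else 0) + p i * (ε' * a i₀) := by
      intro i
      split_ifs with hi
      · exact le_add_of_nonneg_right (mul_nonneg (hp i) (mul_nonneg hε'0 (ha _)))
      · rw [zero_add]; exact mul_le_mul_of_nonneg_left (hCc i hi) (hp i)
    refine (Finset.sum_le_sum fun i _ => this i).trans_eq ?_
    rw [Finset.sum_add_distrib, ← Finset.sum_mul, hp1, one_mul]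
  have h2 : (1 - ε) * A ≤ ∑ i, p i * b i := by
    rw [hA, Finset.mul_sum]
    refine Finset.sum_le_sum fun i _ => ?_
    split_ifs with hi
    · calc (1 - ε) * (p i * a i) = p i * ((1 - ε) * a i) := by ring
        _ ≤ _ := mul_le_mul_of_nonneg_left (hC i hi) (hp i)
    · rw [mul_zero]; exact mul_nonneg (hp i) (hb i)
  have h3 : ε' * a i₀ ≤ ε * A := by
    refine (mul_le_mul_of_nonneg_right hε' (ha i₀)).trans ?_
    rw [mul_assoc]
    exact mul_le_mul_of_nonneg_left h0 hε
  -- With A the prior-weighted mass on `C`, the total is at most (1 + ε)A and the target at least (1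
  -- - ε)A, while q(1 + ε) ≤ q + ε ≤ 1 - ε.
  have h4 : q * ∑ i, p i * a i ≤ q * (A + ε * A) := mul_le_mul_of_nonneg_left (by linarith) hq0
  have h5 : q * (ε * A) ≤ ε * A := mul_le_of_le_one_left (mul_nonneg hε hA0) hq1
  have h6 : (q + 2 * ε) * A ≤ 1 * A := mul_le_mul_of_nonneg_right hq hA0
  linarith

open scoped Classical in
/-- The event that the state is in `Q` and all agents' signals are typical for the state. -/
def typicalEvent [∀ ℓ, Fintype (X ℓ)] (S : InfoStructure Θ X) (Q : Set Θ) (δ : ℝ)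
    (t : ℕ) : Set (World Θ X) :=
  {ω | pathPrefix t ω.2 ∈ if ω.1 ∈ Q then S.typicalSet δ ω.1 t else ∅}

theorem mem_typicalEvent [∀ ℓ, Fintype (X ℓ)] (S : InfoStructure Θ X) {Q : Set Θ} {δ : ℝ} {t : ℕ}
    {ω : World Θ X} :
    ω ∈ S.typicalEvent Q δ t ↔ ω.1 ∈ Q ∧ pathPrefix t ω.2 ∈ S.typicalSet δ ω.1 t := by
  by_cases h : ω.1 ∈ Q <;> simp [typicalEvent, h]

theorem posterior_mono [Fintype Θ] [MeasurableSpace Θ] [∀ ℓ, MeasurableSpace (X ℓ)]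
    (S : InfoStructure Θ X) (ℓ : Fin L) (t : ℕ) {F G : Set (World Θ X)}
    (hFG : F ⊆ G) (ω : World Θ X) : S.posterior ℓ t F ω ≤ S.posterior ℓ t G ω :=
  measureReal_mono hFG

variable [Fintype Θ] [MeasurableSpace Θ] [MeasurableSingletonClass Θ] [∀ ℓ, Fintype (X ℓ)]
  [∀ ℓ, MeasurableSpace (X ℓ)] [∀ ℓ, MeasurableSingletonClass (X ℓ)]

open scoped Classical in
theorem law_history_inter_typicalEvent (S : InfoStructure Θ X) (Q : Set Θ) (δ : ℝ) (ℓ : Fin L)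
    (t : ℕ) (h : Fin t → X ℓ) :
    S.law.real ({ω | history ℓ t ω = h} ∩ S.typicalEvent Q δ t) =
      ∑ θ, (S.prior θ).toReal *
        if θ ∈ Q then S.prob θ (S.typicalSet δ θ t ∩ historySet ℓ h) else 0 := by
  have : {ω : World Θ X | history ℓ t ω = h} ∩ S.typicalEvent Q δ t =
      {ω | pathPrefix t ω.2 ∈ if ω.1 ∈ Q then S.typicalSet δ ω.1 t ∩ historySet ℓ h else ∅} := by
    rw [setOf_history_eq]
    ext ω
    by_cases hQ : ω.1 ∈ Q <;> simp [hQ, typicalEvent, and_comm]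
  rw [law_real, this]
  refine Finset.sum_congr rfl fun θ _ => ?_
  rw [S.lawGiven_prefixEvent θ fun θ =>
    if θ ∈ Q then S.typicalSet δ θ t ∩ historySet ℓ h else ∅]
  split_ifs
  · rfl
  · rw [prob_empty]

theorem le_posterior_of_mul_law_le (S : InfoStructure Θ X) {q : ℝ} {ℓ : Fin L} {t : ℕ}
    {F : Set (World Θ X)} {ω : World Θ X}
    (h0 : 0 < S.law.real {ω' | history ℓ t ω' = history ℓ t ω})
    (h : q * S.law.real {ω' | history ℓ t ω' = history ℓ t ω} ≤
      S.law.real ({ω' | history ℓ t ω' = history ℓ t ω} ∩ F)) : q ≤ S.posterior ℓ t F ω := by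
  rwa [posterior_eq, ← div_eq_inv_mul, le_div_iff₀ h0]

theorem commonlyLearned_of_forall_mem {S : InfoStructure Θ X} (hS : S.PairwiseFullSupport)
    {Q : Set Θ} (hQ : ∀ ℓ, ∀ θ ∈ Q, ∀ θ', S.marginal θ ℓ = S.marginal θ' ℓ → θ' ∈ Q) :
    S.CommonlyLearned Q := by
  classical
  rintro q ⟨hq0, hq1⟩
  obtain ⟨m, hm0, hm1, hm⟩ := hS.exists_le_pairFreq
  obtain ⟨δ, hδ0, hδ⟩ := S.exists_uniform_prod_freq_le
  set N : ℝ := ((Fintype.card (Σ ℓ, X ℓ) : ℕ) : ℝ) with hN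
  have hN0 : 0 ≤ N := Nat.cast_nonneg _
  -- All N fluctuations together must fit into the slack mδ left by the contraction; N + 1 avoids
  -- dividing by zero, and the cap 1 ensures η ≤ 2.
  set η := min 1 (m * δ / (N + 1)) with hη
  have hη0 : 0 < η := lt_min one_pos (by positivity)
  have hη2 : η ≤ 2 := (min_le_left _ _).trans (by norm_num)
  have hηm : η * N ≤ m * δ := by
    calc η * N ≤ η * (N + 1) := by gcongr; linarith
      _ ≤ m * δ / (N + 1) * (N + 1) := by gcongr; exact min_le_right _ _
      _ = m * δ := by field_simp
  have hηδ : η * N ≤ δ := hηm.trans (mul_le_of_le_one_left hδ0.le hm1)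
  -- Gives both q + 2ε ≤ 1 for the posterior bound and the strict 1 - ε > q for the probability of
  -- the event.
  set ε := (1 - q) / 3 with hε
  have hε0 : 0 < ε := by rw [hε]; linarith
  have hlarge : ∀ᶠ t : ℕ in atTop, N * 2 * Real.exp (-(t * (η ^ 2 / 4))) ≤ ε ∧
      ∀ θ, 1 * Real.exp (-(t * δ)) ≤ ε * (S.prior θ).toReal := by
    refine (eventually_mul_exp_le _ (by positivity) hε0).and ?_
    rw [eventually_all]
    exact fun θ => eventually_mul_exp_le _ hδ0 (mul_pos hε0 (S.prior_toReal_pos θ))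
  obtain ⟨T, hT⟩ := eventually_atTop.1 hlarge
  have hev : ∀ t ≥ T, S.IsEvident q t (S.typicalEvent Q δ t) := by
    intro t ht ω hω
    obtain ⟨hωQ, hωt⟩ := S.mem_typicalEvent.1 hω
    refine Set.mem_iInter.2 fun ℓ => ?_
    set h := history ℓ t ω with hh
    have hsupp : ∀ s, S.freq ω.1 ℓ (h s) ≠ 0 := (hωt ℓ).1
    have hdev : S.deviation ω.1 ℓ h ≤ t * δ := (hωt ℓ).2
    have hnn : ∀ θ, 0 ≤ ∏ s, S.freq θ ℓ (h s) := fun θ =>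
      Finset.prod_nonneg fun s _ => S.freq_nonneg _ _ _
    refine S.le_posterior_of_mul_law_le ?_ ?_
    -- Posteriors are 0 at null histories, so evidence requires positive probability here; the
    -- support clause of `typicalSet` supplies it.
    · rw [law_history]
      refine Finset.sum_pos' (fun θ _ => mul_nonneg ENNReal.toReal_nonneg (hnn θ))
        ⟨ω.1, Finset.mem_univ _, mul_pos (S.prior_toReal_pos _) (Finset.prod_pos fun s _ => ?_)⟩
      exact lt_of_le_of_ne (S.freq_nonneg _ _ _) (hsupp s).symm
    · rw [law_history, law_history_inter_typicalEvent]
      -- The states that ℓ cannot tell from the true one all lie in `Q` by `hQ`, and the history is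
      -- typical for each of them; every other state is suppressed by the likelihood bound.
      refine mul_sum_le_sum_of_posterior_odds {θ | S.marginal ω.1 ℓ = S.marginal θ ℓ}
        (i₀ := ω.1) rfl _ _ _ (fun θ => ENNReal.toReal_nonneg) S.prior.sum_toReal_eq_one hnn
        (fun θ => ?_) hq0.le hq1.le hε0.le (by rw [hε]; linarith) ((hT t ht).2 ω.1)
        (by positivity) (fun θ hθ => ?_) fun θ hθ => ?_
      · split_ifs
        exacts [S.prob_nonneg _ _, le_rfl]
      · replace hθ : S.marginal ω.1 ℓ = S.marginal θ ℓ := hθ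
        have hfreq : S.freq ω.1 ℓ = S.freq θ ℓ := by
          funext a; simp only [freq, hθ]
        have hdev' : S.deviation θ ℓ h ≤ t * δ := by
          simpa only [deviation, hfreq] using hdev
        rw [if_pos (hQ ℓ ω.1 hωQ θ hθ)]
        have h1 := S.prob_compl_typicalSet_inter_le θ h hm0 (fun ℓ' => hm θ ℓ ℓ') hm1 hη0.le hη2
          hηm (by rwa [hfreq] at hsupp) hdev'
        have h2 := S.prob_add_prob_compl_inter θ (S.typicalSet δ θ t) (historySet ℓ h)
        have h3 := mul_le_mul_of_nonneg_right (hT t ht).1 (S.prob_nonneg θ (historySet ℓ h))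
        rw [prob_historySet] at h1 h2 h3
        linarith
      · rw [one_mul]
        exact hδ ℓ ω.1 θ hθ t h hsupp hdev
  refine ⟨T, S.typicalEvent Q δ, fun t => ?_, fun t ht θ hθ => ⟨?_, ?_, hev t ht⟩⟩
  · exact measurableSet_prefixEvent fun θ => if θ ∈ Q then S.typicalSet δ θ t else ∅
  -- The event implies that the state is in `Q`, so belief in `Q` follows from evidence by
  -- monotonicity.
  · refine (hev t ht).trans (Set.iInter_mono fun ℓ ω (hω : q ≤ _) => ?_)
    exact hω.trans (S.posterior_mono ℓ t (fun ω hω => (S.mem_typicalEvent.1 hω).1) ω)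
  · rw [typicalEvent, S.lawGiven_prefixEvent θ fun θ => if θ ∈ Q then S.typicalSet δ θ t else ∅,
      if_pos hθ]
    have h1 := S.prob_compl_typicalSet_le θ t hη0.le hη2 hηδ
    have h2 := S.prob_add_prob_compl_inter θ (S.typicalSet δ θ t) Set.univ
    rw [Set.inter_univ, Set.inter_univ, prob_univ] at h2
    have h3 := (hT t ht).1
    linarith

end InfoStructure
end

theorem proposition1 {Θ : Type*} [Fintype Θ] [MeasurableSpace Θ] [MeasurableSingletonClass Θ]
    {L : ℕ} {X : Fin L → Type*} [∀ ℓ, Fintype (X ℓ)] [∀ ℓ, MeasurableSpace (X ℓ)]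
    [∀ ℓ, MeasurableSingletonClass (X ℓ)]
    (S : InfoStructure Θ X) (hS : S.PairwiseFullSupport) (Q : Set Θ) :
    S.CommonlyLearned Q ↔ S.CommonlyIdentified Q := by
  rw [S.commonlyIdentified_iff]
  exact ⟨fun h _ _ hθ _ heq => h.mem_of_marginal_eq hθ heq,
    InfoStructure.commonlyLearned_of_forall_mem hS⟩
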